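/- **Prepare-and-measure behaviours.** Let $\mathcal Q\subset\mathbb R^4$ be the set of tuples $(\mathbf E,\boldsymbol\omega)=(E_1,E_2,\omega_1,\omega_2)$ that are (finite) convex combinations of tuples for which there exist a complex Hilbert space (of arbitrary dimension), two density operators $\rho_1,\rho_2$ on it, a self-adjoint operator $M$ with $-1\le M\le 1$, and a (possibly unbounded) self-adjoint operator $O$ whose spectrum is contained in $\{0\}\cup[1,\infty)$ and for which $0$ is a nondegenerate eigenvalue, such that $$\operatorname{Tr}[\rho_xM]=E_x,\qquad \operatorname{Tr}[\rho_xO]\le\omega_x\qquad(x=1,2).$$ **Bell behaviours.** Let $\mathcal Q_{Bell}\subset\mathbb R^4$ be the set of tuples $(\langle A_xB_y\rangle)_{x,y\in\{1,2\}}$ of the form $\langle A_xB_y\rangle=\operatorname{Tr}[\rho_{AB}\,(A_x\otimes B_y)]$, where $\rho_{AB}$ is a density operator on a tensor product $\mathcal H_A\otimes\mathcal H_B$ of complex Hilbert spaces (of arbitrary dimension), and $A_1,A_2$ on $\mathcal H_A$ and $B_1,B_2$ on $\mathcal H_B$ are self-adjoint operators with $A_x^2=1$, $B_y^2=1$. **Proposition.**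 For $E_1,E_2,\omega_1,\omega_2\in\mathbb R$, the tuple $(\mathbf E,\boldsymbol\omega)$ is in $\mathcal Q$ if and only if there exists a Bell behaviour $(\langle A_xB_y\rangle)_{x,y}\in\mathcal Q_{Bell}$ such that, for $x=1,2$, $$\langle A_xB_1\rangle=E_x,\qquad \langle A_xB_2\rangle\le 2\omega_x-1 .$$ -/

import Mathlib

universe u v w

open scoped TensorProduct InnerProductSpace

namespace EnergyCorrelations

section Operators

variable {H : Type u} [NormedAddCommGroup H] [InnerProductSpace ℂ H] [CompleteSpace H]

/-- `HasTrace T t`: for every orthonormal Hilbert basis `(e i)` of `H`, the family `⟪e i, T (e i)⟫`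
is (unconditionally) summable with sum `t`. Equivalently, `T` is trace class and `Tr T = t`. Every
orthonormal Hilbert basis is, up to relabelling, indexed by a subset of `H`. -/
def HasTrace (T : H →L[ℂ] H) (t : ℂ) : Prop :=
  ∀ (s : Set H) (e : HilbertBasis s ℂ H), HasSum (fun i => ⟪e i, T (e i)⟫_ℂ) t

/-- A (possibly mixed) quantum state, i.e. a density operator: positive, with trace one. -/
structure IsState (ρ : H →L[ℂ] H) : Prop where
  isPositive : ρ.IsPositive
  hasTrace_one : HasTrace ρ 1

/-- The spectrum of a closed, possibly unbounded, operator `O`: the complex numbers `z` for which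
`O - z`, from the domain of `O` to `H`, is not bijective. -/
def unboundedSpectrum (O : H →ₗ.[ℂ] H) : Set ℂ :=
  {z | ¬ Function.Bijective (fun ψ : O.domain => O ψ - z • (ψ : H))}

/-- An energy observable: a self-adjoint, possibly unbounded, operator whose lowest spectral value
is the nondegenerate eigenvalue `0` and whose other spectral values are real and at least `1`. -/
structure IsEnergyObservable (O : H →ₗ.[ℂ] H) : Prop where
  isSelfAdjoint : IsSelfAdjoint O
  gap : ∀ z ∈ unboundedSpectrum O, z = 0 ∨ ∃ r : ℝ, 1 ≤ r ∧ z = r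
  vacuum : Module.finrank ℂ (LinearMap.ker O.toFun) = 1

/-- The expectation value `Tr[ρ O] ∈ [0, ∞]` of a nonnegative, possibly unbounded, self-adjoint
operator `O` in the state `ρ`: the supremum of `Tr[ρ B]` over the bounded operators `B` with
`0 ≤ B ≤ O` in the sense of quadratic forms. For bounded `O` this is `Tr[ρ O]`; in general it is
the limit of `Tr[ρ Oₙ]` for bounded truncations `Oₙ` increasing to `O`, such as
`Oₙ = O (1 + O / n)⁻¹`. -/
noncomputable def meanEnergy (ρ : H →L[ℂ] H) (O : H →ₗ.[ℂ] H) : EReal :=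
  sSup {t : EReal | ∃ (B : H →L[ℂ] H) (r : ℝ), 0 ≤ B ∧
    (∀ ψ : O.domain, (⟪(ψ : H), B ψ⟫_ℂ).re ≤ (⟪(ψ : H), O ψ⟫_ℂ).re) ∧
    HasTrace (ρ * B) (r : ℂ) ∧ t = (r : EReal)}

end Operators

/-- The behaviours `(E, ω)` realised by two states `ρ x`, an observable `-1 ≤ M ≤ 1` and an energy
observable `O` on some complex Hilbert space, without shared randomness: `Tr[ρ x M] = E x` and
`Tr[ρ x O] ≤ ω x`. The two inputs are indexed by `Fin 2`. -/
def realizableBehaviours : Set ((Fin 2 → ℝ) × (Fin 2 → ℝ)) :=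
  {p | ∃ (H : Type u) (_ : NormedAddCommGroup H) (_ : InnerProductSpace ℂ H) (_ : CompleteSpace H)
    (ρ : Fin 2 → H →L[ℂ] H) (M : H →L[ℂ] H) (O : H →ₗ.[ℂ] H),
    (∀ x, IsState (ρ x)) ∧ IsSelfAdjoint M ∧ -1 ≤ M ∧ M ≤ 1 ∧ IsEnergyObservable O ∧
    (∀ x, HasTrace (ρ x * M) (p.1 x : ℂ)) ∧ ∀ x, meanEnergy (ρ x) O ≤ (p.2 x : EReal)}

/-- The set `𝒬` of prepare-and-measure behaviours `(E, ω)` admitting a quantum representation: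
convex combinations (shared randomness) of realisable behaviours. -/
def quantumSet : Set ((Fin 2 → ℝ) × (Fin 2 → ℝ)) :=
  convexHull ℝ realizableBehaviours.{u}

/-- The Hilbert space tensor product. -/
abbrev HilbertTensor (HA : Type v) (HB : Type w) [NormedAddCommGroup HA] [InnerProductSpace ℂ HA]
    [NormedAddCommGroup HB] [InnerProductSpace ℂ HB] : Type (max v w) :=
  UniformSpace.Completion (HA ⊗[ℂ] HB)

/-- The bounded operator `A ⊗ B` on the Hilbert space tensor product. -/
noncomputable def tensorOp {HA : Type v} {HB : Type w} [NormedAddCommGroup HA]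
    [InnerProductSpace ℂ HA] [NormedAddCommGroup HB] [InnerProductSpace ℂ HB]
    (A : HA →L[ℂ] HA) (B : HB →L[ℂ] HB) : HilbertTensor HA HB →L[ℂ] HilbertTensor HA HB :=
  (TensorProduct.mapL A B).completion

/-- The set of quantum Bell behaviours `C x y = ⟨A x B y⟩ = Tr[ρ (A x ⊗ B y)]` in the bipartite
scenario with two binary (`±1`-valued) measurements per party; inputs are indexed by `Fin 2`. -/
def bellQuantumSet : Set (Fin 2 → Fin 2 → ℝ) :=
  {C | ∃ (HA : Type v) (_ : NormedAddCommGroup HA) (_ : InnerProductSpace ℂ HA)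
    (_ : CompleteSpace HA)
    (HB : Type w) (_ : NormedAddCommGroup HB) (_ : InnerProductSpace ℂ HB) (_ : CompleteSpace HB)
    (ρ : HilbertTensor HA HB →L[ℂ] HilbertTensor HA HB)
    (A : Fin 2 → HA →L[ℂ] HA) (B : Fin 2 → HB →L[ℂ] HB),
    IsState ρ ∧ (∀ x, IsSelfAdjoint (A x) ∧ A x ^ 2 = 1) ∧ (∀ y, IsSelfAdjoint (B y) ∧ B y ^ 2 = 1) ∧
    ∀ x y, HasTrace (ρ * tensorOp (A x) (B y)) (C x y : ℂ)}

end EnergyCorrelations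

/-!
Both conditions say that there are unit vectors `b₀`, `b₁`, `a x` of a real Hilbert space with
`⟪a x, b₀⟫ = E x` and `⟪a x, b₁⟫ ≤ 2 ω x - 1`. In terms of Gram matrices, the triples `a x`, `b₀`,
`b₁` are positive semidefinite with a common entry `⟪b₀, b₁⟫`, which is a convex condition on
`(E, ω)`.

For Bell behaviours this is Tsirelson's theorem: real correlations are inner products of the vectors
`(A x ⊗ 1) √ρ` and `(1 ⊗ B y) √ρ` for the Hilbert-Schmidt inner product, and conversely
anticommuting matrices measured on a maximally entangled state realize any such inner products.

In the prepare-and-measure scenario the spectral gap gives `O ≥ 1 - |φ⟩⟨φ|` with `φ` the vacuum, so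
that `1 - 2|φ⟩⟨φ|` plays the role of `B₂`. Its correlation with `M` depends on the state, and hence
on `x`; it is therefore replaced by a smaller observable whose correlation with `M` is `-⟪φ, M φ⟫`
in every state. Conversely, the vectors become Bloch vectors of qubit states and measurements.
-/

namespace EnergyCorrelations

section HilbertSchmidt

variable {𝕜 E F ι κ : Type*} [RCLike 𝕜] [NormedAddCommGroup E] [InnerProductSpace 𝕜 E]
  [NormedAddCommGroup F] [InnerProductSpace 𝕜 F]

theorem hasSum_norm_inner_sq (e : HilbertBasis ι 𝕜 E) (x : E) :
    HasSum (fun i => ‖⟪e i, x⟫_𝕜‖ ^ 2) (‖x‖ ^ 2) := by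
  have h := RCLike.hasSum_re 𝕜 (e.hasSum_inner_mul_inner x x)
  simpa only [inner_mul_symm_re_eq_norm, norm_mul, norm_inner_symm x, ← sq,
    inner_self_eq_norm_sq] using h

theorem summable_prod_norm_inner_sq (f : HilbertBasis κ 𝕜 F) {v : ι → F}
    (hv : Summable fun i => ‖v i‖ ^ 2) :
    Summable fun p : ι × κ => ‖⟪f p.2, v p.1⟫_𝕜‖ ^ 2 := by
  refine (summable_prod_of_nonneg fun p => sq_nonneg _).2
    ⟨fun i => (hasSum_norm_inner_sq f (v i)).summable, ?_⟩
  simpa only [(hasSum_norm_inner_sq f (v _)).tsum_eq] using hv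

variable [CompleteSpace E] [CompleteSpace F]

-- Both series are iterated sums of the array `⟪S (e i), f j⟫ * ⟪f j, T (e i)⟫`.
theorem exists_hasSum_inner_and_hasSum_inner_adjoint (e : HilbertBasis ι 𝕜 E)
    (f : HilbertBasis κ 𝕜 F) {S T : E →L[𝕜] F} (hS : Summable fun i => ‖S (e i)‖ ^ 2)
    (hT : Summable fun i => ‖T (e i)‖ ^ 2) :
    ∃ t, HasSum (fun i => ⟪S (e i), T (e i)⟫_𝕜) t ∧
      HasSum (fun j => ⟪T.adjoint (f j), S.adjoint (f j)⟫_𝕜) t := by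
  have hsum : Summable fun p : ι × κ => ⟪S (e p.1), f p.2⟫_𝕜 * ⟪f p.2, T (e p.1)⟫_𝕜 := by
    refine .of_norm_bounded ((summable_prod_norm_inner_sq f hS).add
      (summable_prod_norm_inner_sq f hT)) fun p => ?_
    rw [norm_mul, norm_inner_symm]
    nlinarith [sq_nonneg (‖⟪f p.2, S (e p.1)⟫_𝕜‖ - ‖⟪f p.2, T (e p.1)⟫_𝕜‖),
      sq_nonneg ‖⟪f p.2, S (e p.1)⟫_𝕜‖, sq_nonneg ‖⟪f p.2, T (e p.1)⟫_𝕜‖]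
  refine ⟨_, hsum.hasSum.prod_fiberwise fun i => f.hasSum_inner_mul_inner _ _, ?_⟩
  refine ((Equiv.prodComm κ ι).hasSum_iff.2 hsum.hasSum).prod_fiberwise fun j => ?_
  simpa only [ContinuousLinearMap.adjoint_inner_left, ContinuousLinearMap.adjoint_inner_right,
    Function.comp_apply, Equiv.prodComm_apply, Prod.swap_prod_mk, mul_comm]
    using e.hasSum_inner_mul_inner (T.adjoint (f j)) (S.adjoint (f j))

end HilbertSchmidt

section Trace

variable {H : Type*} [NormedAddCommGroup H] [InnerProductSpace ℂ H]

theorem re_inner_self (x : H) : (⟪x, x⟫_ℂ).re = ‖x‖ ^ 2 := inner_self_eq_norm_sq (𝕜 := ℂ) x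

theorem re_inner_rankOne_self_apply (x v : H) :
    (⟪v, InnerProductSpace.rankOne ℂ x x v⟫_ℂ).re = ‖⟪x, v⟫_ℂ‖ ^ 2 := by
  rw [InnerProductSpace.rankOne_apply, inner_smul_right, ← inner_conj_symm v x, Complex.mul_conj,
    Complex.normSq_eq_norm_sq, Complex.ofReal_re]

theorem re_inner_apply_nonneg_of_unit {T : H →L[ℂ] H}
    (hT : ∀ v, ‖v‖ = 1 → 0 ≤ (⟪v, T v⟫_ℂ).re) (v : H) : 0 ≤ (⟪v, T v⟫_ℂ).re := by
  rcases eq_or_ne v 0 with rfl | hv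
  · simp
  have h := hT ((‖v‖ : ℂ)⁻¹ • v) (norm_smul_inv_norm hv)
  rw [← Complex.ofReal_inv, map_smul, inner_smul_left, inner_smul_right, Complex.conj_ofReal,
    Complex.re_ofReal_mul, Complex.re_ofReal_mul] at h
  have hpos : 0 < ‖v‖⁻¹ := inv_pos.2 (norm_pos_iff.2 hv)
  exact (mul_nonneg_iff_of_pos_left hpos).1 ((mul_nonneg_iff_of_pos_left hpos).1 h)

theorem HasTrace.add {S T : H →L[ℂ] H} {s t : ℂ} (hS : HasTrace S s) (hT : HasTrace T t) :
    HasTrace (S + T) (s + t) := fun w e => by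
  simpa only [add_apply, inner_add_right] using (hS w e).add (hT w e)

theorem HasTrace.const_smul {T : H →L[ℂ] H} {t : ℂ} (c : ℂ) (hT : HasTrace T t) :
    HasTrace (c • T) (c * t) := fun w e => by
  simpa only [smul_apply, inner_smul_right] using (hT w e).mul_left c

theorem hasTrace_rankOne_mul [CompleteSpace H] (x y : H) (T : H →L[ℂ] H) :
    HasTrace (InnerProductSpace.rankOne ℂ x y * T) ⟪y, T x⟫_ℂ := fun w e => by
  simpa only [mul_apply_eq_comp, InnerProductSpace.rankOne_apply, inner_smul_right,
    ContinuousLinearMap.adjoint_inner_left] using e.hasSum_inner_mul_inner (T.adjoint y) x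

theorem isState_rankOne [CompleteSpace H] {x : H} (hx : ‖x‖ = 1) :
    IsState (InnerProductSpace.rankOne ℂ x x) where
  isPositive := InnerProductSpace.isPositive_rankOne_self x
  hasTrace_one := by simpa [hx] using hasTrace_rankOne_mul x x 1

theorem hasTrace_linearMapTrace [FiniteDimensional ℂ H] (T : H →L[ℂ] H) :
    HasTrace T (LinearMap.trace ℂ H T) := fun w e => by
  have := e.orthonormal.linearIndependent.finite
  have := Fintype.ofFinite w
  rw [LinearMap.trace_eq_sum_inner _ e.toOrthonormalBasis]
  simpa using hasSum_fintype _

variable [CompleteSpace H]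

theorem HasTrace.unique {T : H →L[ℂ] H} {s t : ℂ} (hs : HasTrace T s) (ht : HasTrace T t) :
    s = t := by
  obtain ⟨w, e, -⟩ := exists_hilbertBasis ℂ H
  exact (hs w e).unique (ht w e)

-- `v i` is `√ρ` applied to the `i`-th vector of a fixed basis: the decomposition of the state
-- into (unnormalised) pure ones.
theorem IsState.exists_pure_decomposition {ρ : H →L[ℂ] H} (hρ : IsState ρ) :
    ∃ (s : Set H) (v : s → H), ∀ T : H →L[ℂ] H, ∃ t, HasTrace (ρ * T) t ∧
      HasSum (fun i => ⟪v i, T (v i)⟫_ℂ) t := by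
  have hsqrt : CFC.sqrt ρ * CFC.sqrt ρ = ρ :=
    CFC.sqrt_mul_sqrt_self ρ ((ContinuousLinearMap.nonneg_iff_isPositive ρ).2 hρ.isPositive)
  set A := CFC.sqrt ρ
  have hA : A.adjoint = A := IsSelfAdjoint.of_nonneg (CFC.sqrt_nonneg ρ)
  have hinner (x y : H) : ⟪x, ρ y⟫_ℂ = ⟪A x, A y⟫_ℂ := by
    rw [← hsqrt, mul_apply_eq_comp, ← ContinuousLinearMap.adjoint_inner_left, hA]
  have hnorm {w : Set H} (e : HilbertBasis w ℂ H) : Summable fun i => ‖A (e i)‖ ^ 2 := by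
    refine ((Complex.hasSum_iff _ _).1 (hρ.hasTrace_one w e)).1.summable.congr fun i => ?_
    rw [hinner, re_inner_self]
  obtain ⟨s, e₀, -⟩ := exists_hilbertBasis ℂ H
  have hcyclic (T : H →L[ℂ] H) {w : Set H} (e : HilbertBasis w ℂ H) :
      ∃ t, HasSum (fun i => ⟪A (e₀ i), T (A (e₀ i))⟫_ℂ) t ∧
        HasSum (fun j => ⟪e j, (ρ * T) (e j)⟫_ℂ) t := by
    have hT : Summable fun i => ‖(T.adjoint * A) (e₀ i)‖ ^ 2 :=
      .of_nonneg_of_le (fun i => sq_nonneg _) (fun i => by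
        rw [← mul_pow, mul_apply_eq_comp]
        gcongr
        exact T.adjoint.le_opNorm _) ((hnorm e₀).mul_left (‖T.adjoint‖ ^ 2))
    have hadj : (T.adjoint * A).adjoint = A * T := by
      rw [ContinuousLinearMap.mul_def, ContinuousLinearMap.adjoint_comp, hA,
        ContinuousLinearMap.adjoint_adjoint, ContinuousLinearMap.mul_def]
    simpa only [hinner, hadj, hA, mul_apply_eq_comp, ContinuousLinearMap.adjoint_inner_left]
      using exists_hasSum_inner_and_hasSum_inner_adjoint e₀ e hT (hnorm e₀)
  refine ⟨s, fun i => A (e₀ i), fun T => ?_⟩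
  obtain ⟨t, ht, -⟩ := hcyclic T e₀
  refine ⟨t, fun w e => ?_, ht⟩
  obtain ⟨t', ht', htrace⟩ := hcyclic T e
  rwa [ht.unique ht']

theorem IsState.exists_hasTrace_mul {ρ : H →L[ℂ] H} (hρ : IsState ρ) (T : H →L[ℂ] H) :
    ∃ t, HasTrace (ρ * T) t := by
  obtain ⟨s, v, hv⟩ := hρ.exists_pure_decomposition
  obtain ⟨t, ht, -⟩ := hv T
  exact ⟨t, ht⟩

/-- The expectation value functional `T ↦ Re Tr[ρ T]` of a state `ρ`, on bounded operators. -/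
noncomputable def IsState.expectation {ρ : H →L[ℂ] H} (hρ : IsState ρ) : (H →L[ℂ] H) →ₗ[ℝ] ℝ where
  toFun T := (hρ.exists_hasTrace_mul T).choose.re
  map_add' S T := by
    have h := (hρ.exists_hasTrace_mul S).choose_spec.add (hρ.exists_hasTrace_mul T).choose_spec
    rw [← mul_add] at h
    rw [← Complex.add_re, (hρ.exists_hasTrace_mul (S + T)).choose_spec.unique h]
  map_smul' c T := by
    have h := (hρ.exists_hasTrace_mul T).choose_spec.const_smul (c : ℂ)
    rw [← mul_smul_comm, Complex.coe_smul] at h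
    rw [(hρ.exists_hasTrace_mul (c • T)).choose_spec.unique h, Complex.re_ofReal_mul]
    rfl

section Expectation

variable {ρ S T : H →L[ℂ] H} (hρ : IsState ρ)

theorem IsState.expectation_eq_re {t : ℂ} (h : HasTrace (ρ * T) t) : hρ.expectation T = t.re :=
  congrArg Complex.re ((hρ.exists_hasTrace_mul T).choose_spec.unique h)

theorem IsState.expectation_eq {t : ℝ} (h : HasTrace (ρ * T) (t : ℂ)) : hρ.expectation T = t :=
  hρ.expectation_eq_re h

theorem IsState.expectation_one : hρ.expectation 1 = 1 :=
  hρ.expectation_eq (by simpa only [mul_one, Complex.ofReal_one] using hρ.hasTrace_one)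

theorem IsState.hasTrace_expectation (hT : IsSelfAdjoint T) :
    HasTrace (ρ * T) (hρ.expectation T : ℂ) := by
  obtain ⟨s, v, hv⟩ := hρ.exists_pure_decomposition
  obtain ⟨t, ht, hsum⟩ := hv T
  have him : t.im = 0 := by
    refine ((Complex.hasSum_iff _ _).1 hsum).2.unique ?_
    have hreal (i : s) : (⟪v i, T (v i)⟫_ℂ).im = 0 :=
      (ContinuousLinearMap.isSelfAdjoint_iff_isSymmetric.1 hT).im_inner_self_apply _
    simp only [hreal, hasSum_zero]
  rwa [hρ.expectation_eq_re ht, Complex.ext (Complex.ofReal_re t.re) (him ▸ Complex.ofReal_im _)]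

theorem IsState.expectation_nonneg (hT : ∀ v, ‖v‖ = 1 → 0 ≤ (⟪v, T v⟫_ℂ).re) :
    0 ≤ hρ.expectation T := by
  obtain ⟨s, v, hv⟩ := hρ.exists_pure_decomposition
  obtain ⟨t, ht, hsum⟩ := hv T
  rw [hρ.expectation_eq_re ht]
  exact ((Complex.hasSum_iff _ _).1 hsum).1.nonneg fun i => re_inner_apply_nonneg_of_unit hT (v i)

theorem IsState.expectation_mono (h : ∀ v, ‖v‖ = 1 → (⟪v, S v⟫_ℂ).re ≤ (⟪v, T v⟫_ℂ).re) :
    hρ.expectation S ≤ hρ.expectation T := by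
  rw [← sub_nonneg, ← map_sub]
  refine hρ.expectation_nonneg fun v hv => ?_
  simpa only [sub_apply, inner_sub_right, Complex.sub_re, sub_nonneg] using h v hv

theorem IsState.expectation_le_meanEnergy {B : H →L[ℂ] H} {O : H →ₗ.[ℂ] H} (hB : 0 ≤ B)
    (hBO : ∀ ψ : O.domain, (⟪(ψ : H), B ψ⟫_ℂ).re ≤ (⟪(ψ : H), O ψ⟫_ℂ).re) :
    (hρ.expectation B : EReal) ≤ meanEnergy ρ O :=
  le_sSup ⟨B, _, hB, hBO, hρ.hasTrace_expectation (IsSelfAdjoint.of_nonneg hB), rfl⟩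

theorem IsState.meanEnergy_toPMap_le :
    meanEnergy ρ ((T : H →ₗ[ℂ] H).toPMap ⊤) ≤ (hρ.expectation T : EReal) := by
  refine sSup_le ?_
  rintro _ ⟨B, r, -, hBT, hr, rfl⟩
  rw [← hρ.expectation_eq hr, EReal.coe_le_coe_iff]
  exact hρ.expectation_mono fun v _ => hBT ⟨v, Submodule.mem_top⟩

end Expectation

end Trace

section Resolvent

variable {H : Type*} [NormedAddCommGroup H] [InnerProductSpace ℂ H]

/-- `R` is the resolvent `(O - z)⁻¹`, a bounded two-sided inverse of `O - z : O.domain → H`. -/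
structure IsResolvent (O : H →ₗ.[ℂ] H) (z : ℂ) (R : H →L[ℂ] H) : Prop where
  apply_sub : ∀ ψ : O.domain, R (O ψ - z • (ψ : H)) = ψ
  surjective : Function.Surjective fun ψ : O.domain => O ψ - z • (ψ : H)

theorem IsResolvent.add_inv_mem_unboundedSpectrum [CompleteSpace H] {O : H →ₗ.[ℂ] H} {z μ : ℂ}
    {R : H →L[ℂ] H} (hR : IsResolvent O z R) (hμ : μ ∈ spectrum ℂ R) (hμ0 : μ ≠ 0) :
    z + μ⁻¹ ∈ unboundedSpectrum O := by
  intro hbij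
  refine hμ ?_
  rw [spectrum.mem_resolventSet_iff, ContinuousLinearMap.isUnit_iff_bijective]
  have hz : Function.Bijective fun ψ : O.domain => O ψ - z • (ψ : H) :=
    ⟨fun ψ χ h => Subtype.ext <| by rw [← hR.apply_sub ψ, ← hR.apply_sub χ]; exact congrArg R h,
      hR.surjective⟩
  refine (Function.Bijective.of_comp_iff _ hz).1 ?_
  have hcomp : ⇑(algebraMap ℂ (H →L[ℂ] H) μ - R) ∘ (fun ψ : O.domain => O ψ - z • (ψ : H)) =
      (fun y => μ • y) ∘ fun ψ : O.domain => O ψ - (z + μ⁻¹) • (ψ : H) := by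
    funext ψ
    simp only [Function.comp_apply, sub_apply, Algebra.algebraMap_eq_smul_one, smul_apply,
      one_apply_eq_self, hR.apply_sub, add_smul, smul_sub, smul_add, smul_inv_smul₀ hμ0]
    abel
  rw [hcomp]
  exact (MulAction.bijective₀ hμ0).comp hbij

variable [CompleteSpace H] {O : H →ₗ.[ℂ] H}

theorem inner_apply_left_eq_of_isSelfAdjoint (hO : IsSelfAdjoint O) (ψ χ : O.domain) :
    ⟪O ψ, (χ : H)⟫_ℂ = ⟪(ψ : H), O χ⟫_ℂ := by
  have h := LinearPMap.adjoint_isFormalAdjoint hO.dense_domain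
  rw [LinearPMap.isSelfAdjoint_def.1 hO] at h
  exact h ψ χ

-- The algebraic inverse of `O - z` is symmetric, hence bounded by Hellinger–Toeplitz.
theorem exists_isResolvent_of_isSelfAdjoint (hO : IsSelfAdjoint O) {z : ℝ}
    (hz : (z : ℂ) ∉ unboundedSpectrum O) : ∃ R, IsSelfAdjoint R ∧ IsResolvent O z R := by
  have hbij := not_not.1 hz
  let D : O.domain ≃ₗ[ℂ] H := .ofBijective (O.toFun - (z : ℂ) • O.domain.subtype) hbij
  let R : H →ₗ[ℂ] H := O.domain.subtype ∘ₗ D.symm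
  have hRD (ψ : O.domain) : R (O ψ - (z : ℂ) • (ψ : H)) = ψ :=
    congrArg Subtype.val (D.symm_apply_apply ψ)
  have hsymm : R.IsSymmetric := by
    intro x y
    obtain ⟨ψ, rfl⟩ := hbij.surjective x
    obtain ⟨χ, rfl⟩ := hbij.surjective y
    simp only [hRD, inner_sub_left, inner_sub_right, inner_smul_left, inner_smul_right,
      inner_apply_left_eq_of_isSelfAdjoint hO, Complex.conj_ofReal]
  exact ⟨⟨R, hsymm.continuous⟩, ContinuousLinearMap.isSelfAdjoint_iff_isSymmetric.2 hsymm,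
    hRD, hbij.surjective⟩

end Resolvent

section Gap

variable {H : Type*} [NormedAddCommGroup H] [InnerProductSpace ℂ H] [CompleteSpace H]

-- `(R - a) f(R) (R - a) ≥ 0`, and the range of `R - a` is dense in the orthogonal complement.
theorem re_inner_cfc_nonneg_of_mem_orthogonal_ker {R : H →L[ℂ] H} (hR : IsSelfAdjoint R)
    {f : ℝ → ℝ} {a : ℝ} (hf : ContinuousOn f (spectrum ℝ R))
    (hpos : ∀ x ∈ spectrum ℝ R, x ≠ a → 0 ≤ f x) {v : H}
    (hv : v ∈ (R - algebraMap ℝ (H →L[ℂ] H) a).kerᗮ) : 0 ≤ (⟪v, cfc f R v⟫_ℂ).re := by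
  set S := R - algebraMap ℝ (H →L[ℂ] H) a
  have hS : S.adjoint = S := hR.sub (IsSelfAdjoint.algebraMap _ (.all a))
  have hScfc : S = cfc (fun x => x - a) R := by
    rw [cfc_sub (fun x => x) (fun _ => a) R, cfc_id' ℝ R, cfc_const a R]
  have hSfS : 0 ≤ S * cfc f R * S := by
    rw [hScfc, ← cfc_mul _ f R, ← cfc_mul _ _ R]
    refine cfc_nonneg fun x hx => ?_
    rcases eq_or_ne x a with rfl | hxa
    · simp
    · nlinarith [mul_nonneg (sq_nonneg (x - a)) (hpos x hx hxa)]
  have hclosed : IsClosed {v : H | 0 ≤ (⟪v, cfc f R v⟫_ℂ).re} :=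
    isClosed_le (by fun_prop) (by fun_prop)
  rw [ContinuousLinearMap.orthogonal_ker, hS] at hv
  refine closure_minimal ?_ hclosed hv
  rintro _ ⟨w, rfl⟩
  have h := ((ContinuousLinearMap.nonneg_iff_isPositive _).1 hSfS).re_inner_nonneg_right w
  rwa [mul_assoc, mul_apply_eq_comp, ← ContinuousLinearMap.adjoint_inner_left, hS] at h

variable {O : H →ₗ.[ℂ] H}

theorem IsEnergyObservable.spectrum_resolvent_subset (hO : IsEnergyObservable O)
    {R : H →L[ℂ] H} (hR : IsResolvent O (-1) R) : spectrum ℝ R ⊆ insert 1 (Set.Icc 0 (1 / 2)) := by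
  intro μ hμ
  rcases eq_or_ne μ 0 with rfl | hμ0
  · exact .inr ⟨le_rfl, by norm_num⟩
  have hmem : ((-1 + μ⁻¹ : ℝ) : ℂ) ∈ unboundedSpectrum O := by
    simpa using hR.add_inv_mem_unboundedSpectrum ((spectrum.algebraMap_mem_iff ℂ).2 hμ)
      (Complex.ofReal_ne_zero.2 hμ0)
  rcases hO.gap _ hmem with h | ⟨r, hr, h⟩
  · have hinv := Complex.ofReal_eq_zero.1 h
    exact .inl (inv_eq_one.1 (by linarith))
  · have hinv := Complex.ofReal_inj.1 h
    have hμpos : 0 < μ := inv_pos.1 (by linarith)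
    exact .inr ⟨hμpos.le, by rw [one_div]; exact (le_inv_comm₀ two_pos hμpos).1 (by linarith)⟩

-- With `R = (O + 1)⁻¹`, this is positivity of `R - 2 R²` on the orthogonal complement of the
-- eigenspace of `R` at `1`.
theorem IsEnergyObservable.norm_sq_le_re_inner (hO : IsEnergyObservable O) {ψ : O.domain}
    (hψ : ∀ η : O.domain, O η = 0 → ⟪(η : H), (ψ : H)⟫_ℂ = 0) :
    ‖(ψ : H)‖ ^ 2 ≤ (⟪(ψ : H), O ψ⟫_ℂ).re := by
  have hz : ((-1 : ℝ) : ℂ) ∉ unboundedSpectrum O := fun hmem => by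
    rcases hO.gap _ hmem with h | ⟨r, hr, h⟩
    · norm_num at h
    · linarith [Complex.ofReal_inj.1 h]
  obtain ⟨R, hR, hres⟩ := exists_isResolvent_of_isSelfAdjoint hO.isSelfAdjoint hz
  rw [Complex.ofReal_neg, Complex.ofReal_one] at hres
  have hRapply (χ : O.domain) : R (O χ + χ) = χ := by
    simpa only [neg_one_smul, sub_neg_eq_add] using hres.apply_sub χ
  have hcfc : cfc (fun x : ℝ => x - 2 * (x * x)) R = R - (2 : ℝ) • (R * R) := by
    rw [cfc_sub (fun x : ℝ => x) (fun x => 2 * (x * x)) R, cfc_const_mul (2 : ℝ) _ R,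
      cfc_mul (fun x : ℝ => x) (fun x => x) R, cfc_id' ℝ R]
  have hpos : ∀ x ∈ spectrum ℝ R, x ≠ 1 → 0 ≤ x - 2 * (x * x) := fun x hx hx1 => by
    obtain ⟨h0, h1⟩ := (hO.spectrum_resolvent_subset hres hx).resolve_left hx1
    nlinarith
  have horth : O ψ + (ψ : H) ∈ (R - algebraMap ℝ (H →L[ℂ] H) 1).kerᗮ := by
    rw [Submodule.mem_orthogonal]
    intro y hy
    obtain ⟨η, rfl⟩ := hres.surjective y
    have hη : O η = 0 := by
      simpa [hRapply] using hy
    simp [hη, ← inner_apply_left_eq_of_isSelfAdjoint hO.isSelfAdjoint, hψ η hη, inner_add_right]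
  have h := re_inner_cfc_nonneg_of_mem_orthogonal_ker hR (by fun_prop) hpos horth
  have hRadj : R.adjoint = R := hR
  simp only [hcfc, sub_apply, smul_apply, mul_apply_eq_comp, hRapply, inner_sub_right,
    inner_smul_right_eq_smul] at h
  rw [← ContinuousLinearMap.adjoint_inner_left, hRadj, hRapply, inner_add_left,
    inner_apply_left_eq_of_isSelfAdjoint hO.isSelfAdjoint] at h
  simp only [Complex.sub_re, Complex.add_re, Complex.smul_re, re_inner_self, smul_eq_mul] at h
  linarith

theorem IsEnergyObservable.exists_unit_vacuum (hO : IsEnergyObservable O) :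
    ∃ φ : O.domain, ‖(φ : H)‖ = 1 ∧ O φ = 0 ∧ ∀ η : O.domain, O η = 0 → ∃ c : ℂ, η = c • φ := by
  obtain ⟨φ, hφ0, hspan⟩ := finrank_eq_one_iff'.1 hO.vacuum
  have hn : ‖(φ : H)‖ ≠ 0 := by simpa using hφ0
  have hφ : O (φ : O.domain) = 0 := φ.2
  refine ⟨(‖(φ : H)‖ : ℂ)⁻¹ • (φ : O.domain), ?_, ?_, fun η hη => ?_⟩
  · simp [norm_smul, hn]
  · rw [O.map_smul, hφ, smul_zero]
  · obtain ⟨c, hc⟩ := hspan ⟨η, hη⟩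
    refine ⟨c * ‖(φ : H)‖, ?_⟩
    rw [smul_smul, mul_assoc, mul_inv_cancel₀ (Complex.ofReal_ne_zero.2 hn), mul_one]
    exact (congrArg Subtype.val hc).symm

theorem IsEnergyObservable.exists_norm_sq_sub_le (hO : IsEnergyObservable O) :
    ∃ φ : H, ‖φ‖ = 1 ∧
      ∀ ψ : O.domain, ‖(ψ : H)‖ ^ 2 - ‖⟪φ, (ψ : H)⟫_ℂ‖ ^ 2 ≤ (⟪(ψ : H), O ψ⟫_ℂ).re := by
  obtain ⟨φ, hφ, hOφ, hspan⟩ := hO.exists_unit_vacuum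
  refine ⟨φ, hφ, fun ψ => ?_⟩
  set a := ⟪(φ : H), (ψ : H)⟫_ℂ
  set χ : O.domain := ψ - a • φ
  have hψ : (ψ : H) = χ + a • (φ : H) := by simp [χ]
  have hφχ : ⟪(φ : H), (χ : H)⟫_ℂ = 0 := by
    simp [χ, inner_self_eq_norm_sq_to_K, hφ, a]
  have hχφ : ⟪(χ : H), (φ : H)⟫_ℂ = 0 := inner_eq_zero_symm.1 hφχ
  have hOχ : O χ = O ψ := by rw [O.map_sub, O.map_smul, hOφ, smul_zero, sub_zero]
  have hgap : ‖(χ : H)‖ ^ 2 ≤ (⟪(χ : H), O χ⟫_ℂ).re :=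
    hO.norm_sq_le_re_inner fun η hη => by
      obtain ⟨c, rfl⟩ := hspan η hη
      simp [hφχ]
  have hnorm : ‖(ψ : H)‖ ^ 2 = ‖(χ : H)‖ ^ 2 + ‖a‖ ^ 2 := by
    have h := norm_add_sq_eq_norm_sq_add_norm_sq_of_inner_eq_zero (𝕜 := ℂ) (χ : H) (a • (φ : H))
      (by simp [inner_smul_right, hχφ])
    rw [hψ]
    simpa [norm_smul, hφ, ← sq] using h
  have hform : ⟪(ψ : H), O ψ⟫_ℂ = ⟪(χ : H), O χ⟫_ℂ := by
    rw [← hOχ, hψ, inner_add_left, inner_smul_left,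
      ← inner_apply_left_eq_of_isSelfAdjoint hO.isSelfAdjoint φ, hOφ, inner_zero_left, mul_zero,
      add_zero]
  rw [hform]
  linarith

theorem IsState.one_sub_expectation_rankOne_le_meanEnergy {ρ : H →L[ℂ] H} (hρ : IsState ρ)
    {φ : H} (hφ : ‖φ‖ = 1)
    (hO : ∀ ψ : O.domain, ‖(ψ : H)‖ ^ 2 - ‖⟪φ, (ψ : H)⟫_ℂ‖ ^ 2 ≤ (⟪(ψ : H), O ψ⟫_ℂ).re) :
    ((1 - hρ.expectation (InnerProductSpace.rankOne ℂ φ φ) : ℝ) : EReal) ≤ meanEnergy ρ O := by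
  rw [← hρ.expectation_one, ← map_sub]
  refine hρ.expectation_le_meanEnergy
    (InnerProductSpace.isStarProjection_rankOne_self hφ).one_sub.nonneg fun ψ => ?_
  refine le_trans (le_of_eq ?_) (hO ψ)
  rw [sub_apply, one_apply_eq_self, inner_sub_right, Complex.sub_re, re_inner_self,
    re_inner_rankOne_self_apply]

end Gap

section CorrelationTriple

/-- The matrix `!![1, E, F; E, 1, c; F, c, 1]` is positive semidefinite, in terms of its quadratic
form: `E`, `F`, `c` are the mutual inner products of three unit vectors. -/
def IsCorrelationTriple (E F c : ℝ) : Prop :=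
  ∀ r s t : ℝ, 0 ≤ r ^ 2 + s ^ 2 + t ^ 2 + 2 * r * s * E + 2 * r * t * F + 2 * s * t * c

theorem binaryForm_nonneg_iff {X D Y : ℝ} :
    (∀ r t : ℝ, 0 ≤ r ^ 2 * X + 2 * r * t * D + t ^ 2 * Y) ↔ 0 ≤ X ∧ 0 ≤ Y ∧ D ^ 2 ≤ X * Y := by
  refine ⟨fun h => ⟨by linarith [h 1 0], by linarith [h 0 1], ?_⟩, fun ⟨hX, hY, hD⟩ r t => ?_⟩
  · have hdiscrim := discrim_le_zero (a := X) (b := 2 * D) (c := Y) fun r => by linarith [h r 1]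
    rw [discrim] at hdiscrim
    linarith
  · rcases hX.eq_or_lt with rfl | hX
    · obtain rfl : D = 0 := by nlinarith
      nlinarith [mul_nonneg (sq_nonneg t) hY]
    · refine (mul_nonneg_iff_of_pos_left hX).1 ?_
      nlinarith [sq_nonneg (r * X + t * D), mul_nonneg (sq_nonneg t) (sub_nonneg.2 hD)]

-- Completing the square in `s` leaves the binary form of the Schur complement.
theorem isCorrelationTriple_iff {E F c : ℝ} :
    IsCorrelationTriple E F c ↔
      E ^ 2 ≤ 1 ∧ c ^ 2 ≤ 1 ∧ (F - c * E) ^ 2 ≤ (1 - E ^ 2) * (1 - c ^ 2) := by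
  rw [← sub_nonneg (b := E ^ 2), ← sub_nonneg (b := c ^ 2), ← binaryForm_nonneg_iff]
  refine ⟨fun h r t => ?_, fun h r s t => ?_⟩
  · linear_combination h r (-(r * E + t * c)) t
  · linear_combination h r t + sq_nonneg (s + r * E + t * c)

theorem isCorrelationTriple_re_inner {𝕜 V : Type*} [RCLike 𝕜] [NormedAddCommGroup V]
    [InnerProductSpace 𝕜 V] {x y z : V} (hx : ‖x‖ = 1) (hy : ‖y‖ = 1) (hz : ‖z‖ = 1) :
    IsCorrelationTriple (RCLike.re ⟪x, y⟫_𝕜) (RCLike.re ⟪x, z⟫_𝕜) (RCLike.re ⟪y, z⟫_𝕜) := by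
  intro r s t
  have h := inner_self_nonneg (𝕜 := 𝕜) (x := (r : 𝕜) • x + (s : 𝕜) • y + (t : 𝕜) • z)
  simp only [inner_add_left, inner_add_right, inner_smul_left, inner_smul_right, map_add,
    RCLike.conj_ofReal, RCLike.re_ofReal_mul, inner_self_eq_norm_sq, hx, hy, hz,
    inner_re_symm y x, inner_re_symm z x, inner_re_symm z y] at h
  linarith

/-- The pairs `(E, ω)` for which there are vectors `b₀`, `b₁` and, for each `x`, a vector `a x`, all
of unit length, with `⟪a x, b₀⟫ = E x` and `⟪a x, b₁⟫ ≤ 2 ω x - 1`; stated through Gram matrices. -/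
def gramSet : Set ((Fin 2 → ℝ) × (Fin 2 → ℝ)) :=
  {p | ∃ (F : Fin 2 → ℝ) (c : ℝ),
    ∀ x, IsCorrelationTriple (p.1 x) (F x) c ∧ F x ≤ 2 * p.2 x - 1}

theorem convex_gramSet : Convex ℝ gramSet := by
  rintro p ⟨F, c, hF⟩ p' ⟨F', c', hF'⟩ a b ha hb hab
  obtain rfl : b = 1 - a := by linarith
  refine ⟨a • F + (1 - a) • F', a * c + (1 - a) * c', fun x => ⟨fun r s t => ?_, ?_⟩⟩ <;>
    simp only [Prod.fst_add, Prod.snd_add, Prod.smul_fst, Prod.smul_snd, Pi.add_apply,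
      Pi.smul_apply, smul_eq_mul]
  · linarith [mul_nonneg ha ((hF x).1 r s t), mul_nonneg hb ((hF' x).1 r s t)]
  · linarith [mul_le_mul_of_nonneg_left (hF x).2 ha, mul_le_mul_of_nonneg_left (hF' x).2 hb]

theorem IsState.isCorrelationTriple_expectation {H : Type*} [NormedAddCommGroup H]
    [InnerProductSpace ℂ H] [CompleteSpace H] {ρ : H →L[ℂ] H} (hρ : IsState ρ) {X Y Z : H →L[ℂ] H}
    (h : ∀ v, ‖v‖ = 1 →
      IsCorrelationTriple (⟪v, X v⟫_ℂ).re (⟪v, Y v⟫_ℂ).re (⟪v, Z v⟫_ℂ).re) :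
    IsCorrelationTriple (hρ.expectation X) (hρ.expectation Y) (hρ.expectation Z) := by
  intro r s t
  have hform : 0 ≤ hρ.expectation ((r ^ 2 + s ^ 2 + t ^ 2) • 1 + (2 * r * s) • X +
      (2 * r * t) • Y + (2 * s * t) • Z) := by
    refine hρ.expectation_nonneg fun v hv => ?_
    simp only [add_apply, smul_apply, one_apply_eq_self, inner_add_right,
      inner_smul_right_eq_smul, Complex.add_re, Complex.smul_re, smul_eq_mul, re_inner_self, hv]
    linarith [h v hv r s t]
  simp only [map_add, map_smul, smul_eq_mul, hρ.expectation_one] at hform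
  linarith

end CorrelationTriple

section AlignedObservable

variable {H : Type*} [NormedAddCommGroup H] [InnerProductSpace ℂ H]

/-- For `-1 ≤ M ≤ 1` and a unit vector `φ`, an observable below `1 - 2|φ⟩⟨φ|` that is jointly
correlated with `M`, in every state, as unit vectors with inner product `-⟪φ, M φ⟫` would be. If
`M² = 1` and `P = |φ⟩⟨φ|` it is `M P M - P - ⟪φ, M φ⟫ M`, which agrees with `1 - 2 P` on the span of
`φ` and `M φ`. -/
noncomputable def alignedObservable (M : H →L[ℂ] H) (φ : H) : H →L[ℂ] H :=
  InnerProductSpace.rankOne ℂ (M φ) (M φ) - InnerProductSpace.rankOne ℂ φ φ -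
    (⟪φ, M φ⟫_ℂ).re • M

theorem re_inner_alignedObservable (M : H →L[ℂ] H) (φ v : H) :
    (⟪v, alignedObservable M φ v⟫_ℂ).re =
      ‖⟪M φ, v⟫_ℂ‖ ^ 2 - ‖⟪φ, v⟫_ℂ‖ ^ 2 - (⟪φ, M φ⟫_ℂ).re * (⟪v, M v⟫_ℂ).re := by
  simp only [alignedObservable, sub_apply, smul_apply, inner_sub_right, Complex.sub_re,
    re_inner_rankOne_self_apply, inner_smul_right_eq_smul, Complex.smul_re, smul_eq_mul]

variable [CompleteSpace H]

theorem re_inner_apply_le_of_le {S T : H →L[ℂ] H} (h : S ≤ T) (v : H) :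
    (⟪v, S v⟫_ℂ).re ≤ (⟪v, T v⟫_ℂ).re := by
  have hv := ((ContinuousLinearMap.nonneg_iff_isPositive _).1
    (sub_nonneg.2 h)).re_inner_nonneg_right v
  simpa only [sub_apply, inner_sub_right, map_sub, sub_nonneg, RCLike.re_to_complex] using hv

theorem norm_inner_apply_sq_le {P : H →L[ℂ] H} (hP : 0 ≤ P) (x y : H) :
    ‖⟪x, P y⟫_ℂ‖ ^ 2 ≤ (⟪x, P x⟫_ℂ).re * (⟪y, P y⟫_ℂ).re := by
  have hsqrt : CFC.sqrt P * CFC.sqrt P = P := CFC.sqrt_mul_sqrt_self P hP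
  set A := CFC.sqrt P
  have hA : A.adjoint = A := IsSelfAdjoint.of_nonneg (CFC.sqrt_nonneg P)
  have hinner (x y : H) : ⟪x, P y⟫_ℂ = ⟪A x, A y⟫_ℂ := by
    rw [← hsqrt, mul_apply_eq_comp, ← ContinuousLinearMap.adjoint_inner_left, hA]
  rw [hinner, hinner, hinner, re_inner_self, re_inner_self, ← mul_pow]
  gcongr
  exact norm_inner_le_norm _ _

theorem norm_inner_add_inner_apply_sq_le {M : H →L[ℂ] H} (hM : -1 ≤ M) {φ v : H}
    (hφ : ‖φ‖ = 1) (hv : ‖v‖ = 1) :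
    ‖⟪φ, v⟫_ℂ + ⟪M φ, v⟫_ℂ‖ ^ 2 ≤ (1 + (⟪φ, M φ⟫_ℂ).re) * (1 + (⟪v, M v⟫_ℂ).re) := by
  have hpos : 0 ≤ 1 + M := neg_le_iff_add_nonneg'.1 hM
  have hself : IsSelfAdjoint M := by
    simpa using (IsSelfAdjoint.of_nonneg hpos).sub (.one (H →L[ℂ] H))
  have hadj : M.adjoint = M := hself
  have h := norm_inner_apply_sq_le hpos φ v
  simpa only [add_apply, one_apply_eq_self, inner_add_right, Complex.add_re, re_inner_self, hφ, hv,
    one_pow, ← ContinuousLinearMap.adjoint_inner_left M, hadj] using h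

theorem norm_inner_sub_inner_apply_sq_le {M : H →L[ℂ] H} (hM : M ≤ 1) {φ v : H}
    (hφ : ‖φ‖ = 1) (hv : ‖v‖ = 1) :
    ‖⟪φ, v⟫_ℂ - ⟪M φ, v⟫_ℂ‖ ^ 2 ≤ (1 - (⟪φ, M φ⟫_ℂ).re) * (1 - (⟪v, M v⟫_ℂ).re) := by
  simpa only [neg_apply, inner_neg_left, inner_neg_right, Complex.neg_re, ← sub_eq_add_neg]
    using norm_inner_add_inner_apply_sq_le (neg_le_neg hM) hφ hv

theorem sq_norm_sq_sub_norm_sq_le (z w : ℂ) :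
    (‖w‖ ^ 2 - ‖z‖ ^ 2) ^ 2 ≤ ‖z + w‖ ^ 2 * ‖z - w‖ ^ 2 := by
  rw [← mul_pow, ← norm_mul, ← sq_sub_sq, ← norm_pow, ← norm_pow, sq_le_sq, abs_norm,
    abs_sub_comm]
  exact abs_norm_sub_norm_le _ _

section Unit

variable {M : H →L[ℂ] H} (hM : -1 ≤ M) (hM' : M ≤ 1) {φ v : H} (hφ : ‖φ‖ = 1) (hv : ‖v‖ = 1)
include hM hM' hφ hv

theorem re_inner_alignedObservable_le :
    (⟪v, alignedObservable M φ v⟫_ℂ).re ≤ 1 - 2 * ‖⟪φ, v⟫_ℂ‖ ^ 2 := by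
  have hadd := norm_inner_add_inner_apply_sq_le hM hφ hv
  have hsub := norm_inner_sub_inner_apply_sq_le hM' hφ hv
  have hpar := parallelogram_law_with_norm ℂ ⟪φ, v⟫_ℂ ⟪M φ, v⟫_ℂ
  rw [re_inner_alignedObservable]
  linarith

theorem isCorrelationTriple_alignedObservable :
    IsCorrelationTriple (⟪v, M v⟫_ℂ).re (⟪v, alignedObservable M φ v⟫_ℂ).re (-(⟪φ, M φ⟫_ℂ).re) := by
  have habs {w : H} (hw : ‖w‖ = 1) : (⟪w, M w⟫_ℂ).re ^ 2 ≤ 1 := by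
    have hlow := re_inner_apply_le_of_le hM w
    have hupp := re_inner_apply_le_of_le hM' w
    simp only [neg_apply, one_apply_eq_self, inner_neg_right, Complex.neg_re, re_inner_self, hw,
      one_pow] at hlow hupp
    exact (sq_le_one_iff_abs_le_one _).2 (abs_le.2 ⟨hlow, hupp⟩)
  refine isCorrelationTriple_iff.2 ⟨habs hv, by simpa only [neg_sq] using habs hφ, ?_⟩
  rw [re_inner_alignedObservable]
  have hadd := norm_inner_add_inner_apply_sq_le hM hφ hv
  have hsub := norm_inner_sub_inner_apply_sq_le hM' hφ hv
  have hprod := mul_le_mul hadd hsub (sq_nonneg _) ((sq_nonneg _).trans hadd)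
  linarith [sq_norm_sq_sub_norm_sq_le ⟪φ, v⟫_ℂ ⟪M φ, v⟫_ℂ]

end Unit

end AlignedObservable

theorem realizableBehaviours_subset_gramSet : realizableBehaviours.{u} ⊆ gramSet := by
  rintro p ⟨H, _, _, _, ρ, M, O, hρ, -, hM, hM', hO, hE, hω⟩
  obtain ⟨φ, hφ, hOφ⟩ := hO.exists_norm_sq_sub_le
  refine ⟨fun x => (hρ x).expectation (alignedObservable M φ), -(⟪φ, M φ⟫_ℂ).re,
    fun x => ⟨?_, ?_⟩⟩
  · have h := (hρ x).isCorrelationTriple_expectation (X := M) (Y := alignedObservable M φ)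
      (Z := (-(⟪φ, M φ⟫_ℂ).re) • 1) fun v hv => by
        simpa only [smul_apply, one_apply_eq_self, inner_smul_right_eq_smul, Complex.smul_re,
          re_inner_self, hv, one_pow, smul_eq_mul, mul_one]
          using isCorrelationTriple_alignedObservable hM hM' hφ hv
    rwa [map_smul, (hρ x).expectation_one, (hρ x).expectation_eq (hE x), smul_eq_mul, mul_one] at h
  · have haligned : (hρ x).expectation (alignedObservable M φ) ≤
        (hρ x).expectation (1 - (2 : ℝ) • InnerProductSpace.rankOne ℂ φ φ) :=
      (hρ x).expectation_mono fun v hv => by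
        simpa only [sub_apply, smul_apply, one_apply_eq_self, inner_sub_right, Complex.sub_re,
          inner_smul_right_eq_smul, Complex.smul_re, re_inner_self, re_inner_rankOne_self_apply,
          hv, one_pow, smul_eq_mul] using re_inner_alignedObservable_le hM hM' hφ hv
    rw [map_sub, map_smul, (hρ x).expectation_one, smul_eq_mul] at haligned
    have henergy := EReal.coe_le_coe_iff.1
      (((hρ x).one_sub_expectation_rankOne_le_meanEnergy hφ hOφ).trans (hω x))
    linarith

theorem quantumSet_subset_gramSet : quantumSet.{u} ⊆ gramSet :=
  convexHull_min realizableBehaviours_subset_gramSet convex_gramSet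

section Tensor

variable {HA : Type v} {HB : Type w} [NormedAddCommGroup HA] [InnerProductSpace ℂ HA]
  [NormedAddCommGroup HB] [InnerProductSpace ℂ HB]

theorem tensorOp_coe (A : HA →L[ℂ] HA) (B : HB →L[ℂ] HB) (x : HA ⊗[ℂ] HB) :
    tensorOp A B (x : HilbertTensor HA HB) =
      ((TensorProduct.mapL A B x : HA ⊗[ℂ] HB) : HilbertTensor HA HB) :=
  ContinuousLinearMap.completion_apply_coe _ _

theorem tensorOp_mul (A A' : HA →L[ℂ] HA) (B B' : HB →L[ℂ] HB) :
    tensorOp A B * tensorOp A' B' = tensorOp (A * A') (B * B') := by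
  ext x
  induction x using UniformSpace.Completion.induction_on with
  | hp => exact isClosed_eq (ContinuousLinearMap.continuous _) (ContinuousLinearMap.continuous _)
  | ih x => rw [mul_apply_eq_comp, tensorOp_coe, tensorOp_coe, tensorOp_coe,
      TensorProduct.mapL_mul, mul_apply_eq_comp]

theorem tensorOp_one_one : tensorOp (1 : HA →L[ℂ] HA) (1 : HB →L[ℂ] HB) = 1 := by
  ext x
  induction x using UniformSpace.Completion.induction_on with
  | hp => exact isClosed_eq (ContinuousLinearMap.continuous _) (ContinuousLinearMap.continuous _)
  | ih x =>
    rw [tensorOp_coe, one_apply_eq_self]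
    exact congrArg (fun T : HA ⊗[ℂ] HB →L[ℂ] HA ⊗[ℂ] HB => (T x : HilbertTensor HA HB))
      TensorProduct.mapL_id_id

theorem tensorOp_sq_eq_one {A : HA →L[ℂ] HA} {B : HB →L[ℂ] HB} (hA : A ^ 2 = 1) (hB : B ^ 2 = 1) :
    tensorOp A B ^ 2 = 1 := by
  rw [sq, tensorOp_mul, ← sq, ← sq, hA, hB, tensorOp_one_one]

variable [CompleteSpace HA] [CompleteSpace HB]

theorem adjoint_tensorOp (A : HA →L[ℂ] HA) (B : HB →L[ℂ] HB) :
    (tensorOp A B).adjoint = tensorOp A.adjoint B.adjoint := by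
  refine ((ContinuousLinearMap.eq_adjoint_iff _ _).2 fun x y => ?_).symm
  induction x, y using UniformSpace.Completion.induction_on₂ with
  | hp => exact isClosed_eq (by fun_prop) (by fun_prop)
  | ih x y =>
    rw [tensorOp_coe, tensorOp_coe, UniformSpace.Completion.inner_coe,
      UniformSpace.Completion.inner_coe]
    induction x with
    | zero => simp only [map_zero, inner_zero_left]
    | add x x' hx hx' => simp only [map_add, inner_add_left, hx, hx']
    | tmul a b =>
      induction y with
      | zero => simp only [map_zero, inner_zero_right]
      | add y y' hy hy' => simp only [map_add, inner_add_right, hy, hy']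
      | tmul a' b' =>
        simp only [TensorProduct.mapL_tmul, TensorProduct.inner_tmul,
          ContinuousLinearMap.adjoint_inner_left]

theorem isSelfAdjoint_tensorOp {A : HA →L[ℂ] HA} {B : HB →L[ℂ] HB} (hA : IsSelfAdjoint A)
    (hB : IsSelfAdjoint B) : IsSelfAdjoint (tensorOp A B) :=
  (adjoint_tensorOp A B).trans (congrArg₂ tensorOp hA hB)

end Tensor

theorem norm_apply_eq_norm_of_sq_eq_one {H : Type*} [NormedAddCommGroup H] [InnerProductSpace ℂ H]
    [CompleteSpace H] {A : H →L[ℂ] H} (hA : IsSelfAdjoint A) (hsq : A ^ 2 = 1) (v : H) :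
    ‖A v‖ = ‖v‖ := by
  have hstar : star A * A = 1 := by rw [hA.star_eq, ← sq, hsq]
  exact (ContinuousLinearMap.norm_map_iff_adjoint_comp_self A).2 hstar v

theorem isCorrelationTriple_re_inner_mul {H : Type*} [NormedAddCommGroup H] [InnerProductSpace ℂ H]
    [CompleteSpace H] {X Y Z : H →L[ℂ] H} (hX : IsSelfAdjoint X ∧ X ^ 2 = 1)
    (hY : IsSelfAdjoint Y ∧ Y ^ 2 = 1) (hZ : IsSelfAdjoint Z ∧ Z ^ 2 = 1) {v : H} (hv : ‖v‖ = 1) :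
    IsCorrelationTriple (⟪v, (X * Y) v⟫_ℂ).re (⟪v, (X * Z) v⟫_ℂ).re (⟪v, (Y * Z) v⟫_ℂ).re := by
  have hunit {A : H →L[ℂ] H} (hA : IsSelfAdjoint A ∧ A ^ 2 = 1) : ‖A v‖ = 1 :=
    (norm_apply_eq_norm_of_sq_eq_one hA.1 hA.2 v).trans hv
  have hinner {A : H →L[ℂ] H} (hA : IsSelfAdjoint A ∧ A ^ 2 = 1) (B : H →L[ℂ] H) :
      ⟪v, (A * B) v⟫_ℂ = ⟪A v, B v⟫_ℂ := by
    have hadj : A.adjoint = A := hA.1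
    rw [mul_apply_eq_comp, ← ContinuousLinearMap.adjoint_inner_left, hadj]
  rw [hinner hX, hinner hX, hinner hY]
  exact isCorrelationTriple_re_inner (𝕜 := ℂ) (hunit hX) (hunit hY) (hunit hZ)

theorem exists_isCorrelationTriple_of_mem_bellQuantumSet {C : Fin 2 → Fin 2 → ℝ}
    (hC : C ∈ bellQuantumSet.{v, w}) : ∃ c, ∀ x, IsCorrelationTriple (C x 0) (C x 1) c := by
  obtain ⟨HA, _, _, _, HB, _, _, _, ρ, A, B, hρ, hA, hB, hC⟩ := hC
  have hAliceBob (x y : Fin 2) : tensorOp (A x) 1 * tensorOp 1 (B y) = tensorOp (A x) (B y) := by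
    rw [tensorOp_mul, mul_one, one_mul]
  have hAlice (x : Fin 2) : IsSelfAdjoint (tensorOp (A x) (1 : HB →L[ℂ] HB)) ∧
      tensorOp (A x) (1 : HB →L[ℂ] HB) ^ 2 = 1 :=
    ⟨isSelfAdjoint_tensorOp (hA x).1 (.one _), tensorOp_sq_eq_one (hA x).2 (one_pow 2)⟩
  have hBob (y : Fin 2) : IsSelfAdjoint (tensorOp (1 : HA →L[ℂ] HA) (B y)) ∧
      tensorOp (1 : HA →L[ℂ] HA) (B y) ^ 2 = 1 :=
    ⟨isSelfAdjoint_tensorOp (.one _) (hB y).1, tensorOp_sq_eq_one (one_pow 2) (hB y).2⟩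
  refine ⟨hρ.expectation (tensorOp 1 (B 0) * tensorOp 1 (B 1)), fun x => ?_⟩
  have h := hρ.isCorrelationTriple_expectation fun v hv =>
    isCorrelationTriple_re_inner_mul (hAlice x) (hBob 0) (hBob 1) hv
  rwa [hAliceBob, hAliceBob, hρ.expectation_eq (hC x 0), hρ.expectation_eq (hC x 1)] at h

section Bloch

-- With `b 0 = e₂` and `b 1` in the `e₀`-`e₂` plane, the prescribed inner products fix two
-- coordinates of `a x`; the third, along `e₁`, is left for the normalisation.
theorem exists_unit_vectors_of_isCorrelationTriple {ι : Type*} [Nonempty ι] {E F : ι → ℝ} {c : ℝ}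
    (h : ∀ x, IsCorrelationTriple (E x) (F x) c) :
    ∃ (a : ι → Fin 3 → ℝ) (b : Fin 2 → Fin 3 → ℝ), (∀ x, a x ⬝ᵥ a x = 1) ∧
      (∀ y, b y ⬝ᵥ b y = 1) ∧ (∀ x, a x ⬝ᵥ b 0 = E x) ∧ ∀ x, a x ⬝ᵥ b 1 = F x := by
  have hc : 0 ≤ 1 - c ^ 2 :=
    sub_nonneg.2 (isCorrelationTriple_iff.1 (h (Classical.arbitrary ι))).2.1
  set s := √(1 - c ^ 2)
  have hs : s ^ 2 = 1 - c ^ 2 := Real.sq_sqrt hc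
  set u : ι → ℝ := fun x => (F x - c * E x) / s
  have hE (x : ι) : 0 ≤ 1 - E x ^ 2 := sub_nonneg.2 (isCorrelationTriple_iff.1 (h x)).1
  have hSchur (x : ι) : (F x - c * E x) ^ 2 ≤ (1 - E x ^ 2) * s ^ 2 :=
    hs ▸ (isCorrelationTriple_iff.1 (h x)).2.2
  have hus (x : ι) : u x * s = F x - c * E x :=
    div_mul_cancel_of_imp fun hs0 => by simpa [hs0] using hSchur x
  have hu (x : ι) : 0 ≤ 1 - E x ^ 2 - u x ^ 2 := by
    rw [sub_nonneg, div_pow]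
    exact div_le_of_le_mul₀ (sq_nonneg s) (hE x) (hSchur x)
  refine ⟨fun x => ![u x, √(1 - E x ^ 2 - u x ^ 2), E x], ![![0, 0, 1], ![s, 0, c]],
    fun x => ?_, fun y => ?_, fun x => ?_, fun x => ?_⟩
  · simp only [Matrix.vec3_dotProduct', Real.mul_self_sqrt (hu x)]
    ring
  · fin_cases y <;> simp [← sq, hs]
  · simp
  · simp [hus, mul_comm]

/-- The traceless Hermitian matrix with Bloch vector `a`, i.e. `a 0 σ_x + a 1 σ_y + a 2 σ_z` for the
Pauli matrices `σ_x`, `σ_y`, `σ_z`. -/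
def blochMatrix (a : Fin 3 → ℝ) : Matrix (Fin 2) (Fin 2) ℂ :=
  !![(a 2 : ℂ), a 0 - a 1 * Complex.I; a 0 + a 1 * Complex.I, -a 2]

theorem isHermitian_blochMatrix (a : Fin 3 → ℝ) : (blochMatrix a).IsHermitian := by
  ext i j
  fin_cases i <;> fin_cases j <;> simp [blochMatrix, sub_eq_add_neg]

theorem trace_blochMatrix (a : Fin 3 → ℝ) : (blochMatrix a).trace = 0 := by
  simp [blochMatrix, Matrix.trace_fin_two]

theorem blochMatrix_mul_self (a : Fin 3 → ℝ) :
    blochMatrix a * blochMatrix a = ((a ⬝ᵥ a : ℝ) : ℂ) • 1 := by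
  ext i j
  fin_cases i <;> fin_cases j <;>
    simp only [blochMatrix, Matrix.mul_apply, Fin.sum_univ_two, dotProduct, Fin.sum_univ_three] <;>
    simp <;> grind [Complex.I_mul_I]

theorem trace_blochMatrix_mul (a b : Fin 3 → ℝ) :
    (blochMatrix a * blochMatrix b).trace = 2 * ((a ⬝ᵥ b : ℝ) : ℂ) := by
  simp only [blochMatrix, Matrix.mul_apply, Fin.sum_univ_two, Fin.sum_univ_three, Matrix.trace,
    dotProduct, Matrix.diag]
  simp
  linear_combination (-2 * (a 1 * b 1 : ℂ)) * Complex.I_mul_I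

end Bloch

section Qubit

/-- The Hilbert space `ℂ²`, in an arbitrary universe. -/
abbrev Qubit : Type u := EuclideanSpace ℂ (ULift.{u} (Fin 2))

/-- The standard basis of `ℂ²`. -/
noncomputable def qubitBasis : OrthonormalBasis (Fin 2) ℂ Qubit.{u} :=
  (EuclideanSpace.basisFun (ULift.{u} (Fin 2)) ℂ).reindex Equiv.ulift

/-- The operator on `ℂ²` with a given matrix. -/
noncomputable def qubitOp : Matrix (Fin 2) (Fin 2) ℂ ≃⋆ₐ[ℂ] (Qubit.{u} →L[ℂ] Qubit.{u}) :=
  (StarAlgEquiv.ofAlgEquiv (Matrix.reindexAlgEquiv ℂ ℂ Equiv.ulift.{u}.symm)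
    fun M => Matrix.conjTranspose_reindex _ _ M).trans Matrix.toEuclideanCLM

theorem inner_qubitBasis_qubitOp (M : Matrix (Fin 2) (Fin 2) ℂ) (i j : Fin 2) :
    ⟪qubitBasis.{u} i, qubitOp M (qubitBasis j)⟫_ℂ = M i j := by
  have hop : qubitOp.{u} M =
      Matrix.toEuclideanCLM (𝕜 := ℂ) (M.submatrix ULift.down ULift.down) := rfl
  simp [qubitBasis, hop, EuclideanSpace.inner_single_left]

theorem trace_qubitOp (M : Matrix (Fin 2) (Fin 2) ℂ) :
    LinearMap.trace ℂ Qubit.{u} (qubitOp M) = M.trace := by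
  rw [LinearMap.trace_eq_sum_inner _ qubitBasis]
  exact Finset.sum_congr rfl fun i _ => inner_qubitBasis_qubitOp M i i

end Qubit

section BoundedEnergy

variable {H : Type*} [NormedAddCommGroup H] [InnerProductSpace ℂ H]

theorem finrank_ker_toPMap_top (T : H →ₗ[ℂ] H) :
    Module.finrank ℂ (LinearMap.ker (T.toPMap ⊤).toFun) = Module.finrank ℂ (LinearMap.ker T) := by
  let e : (T.toPMap ⊤).domain ≃ₗ[ℂ] H := Submodule.topEquiv
  have hker : (LinearMap.ker (T.toPMap ⊤).toFun).map (e : _ →ₗ[ℂ] H) = LinearMap.ker T := by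
    rw [Submodule.map_equiv_eq_comap_symm]
    rfl
  rw [← hker, LinearEquiv.finrank_map_eq]

variable [CompleteSpace H]

theorem unboundedSpectrum_toPMap_top (T : H →L[ℂ] H) :
    unboundedSpectrum ((T : H →ₗ[ℂ] H).toPMap ⊤) = spectrum ℂ T := by
  ext z
  rw [spectrum.mem_iff, ← IsUnit.neg_iff, neg_sub, ContinuousLinearMap.isUnit_iff_bijective]
  exact not_congr (Function.Bijective.of_comp_iff (T - algebraMap ℂ (H →L[ℂ] H) z)
    (Submodule.topEquiv (R := ℂ) (M := H)).bijective)

theorem isSelfAdjoint_toPMap_top {T : H →L[ℂ] H} (hT : IsSelfAdjoint T) :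
    IsSelfAdjoint ((T : H →ₗ[ℂ] H).toPMap ⊤) := by
  have h := T.toPMap_adjoint_eq_adjoint_toPMap_of_dense (p := ⊤) dense_univ
  rw [LinearPMap.isSelfAdjoint_def, h, ContinuousLinearMap.isSelfAdjoint_iff'.1 hT]

theorem isEnergyObservable_toPMap_top {Q : H →L[ℂ] H} (hQ : IsStarProjection Q)
    (hker : Module.finrank ℂ (LinearMap.ker (Q : H →ₗ[ℂ] H)) = 1) :
    IsEnergyObservable ((Q : H →ₗ[ℂ] H).toPMap ⊤) where
  isSelfAdjoint := isSelfAdjoint_toPMap_top hQ.isSelfAdjoint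
  gap z hz := by
    rw [unboundedSpectrum_toPMap_top] at hz
    refine (hQ.isIdempotentElem.spectrum_subset ℂ hz).imp id fun h => ⟨1, le_rfl, ?_⟩
    simpa using h
  vacuum := (finrank_ker_toPMap_top _).trans hker

theorem neg_one_le_of_sq_eq_one {M : H →L[ℂ] H} (hM : IsSelfAdjoint M) (hsq : M ^ 2 = 1) :
    -1 ≤ M := by
  have hhalf : M - -1 = (2⁻¹ : ℝ) • ((1 + M) * (1 + M)) := by
    rw [← sq, (Commute.one_left M).add_sq, hsq, one_pow, mul_one, two_mul]
    module
  rw [← sub_nonneg, hhalf]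
  exact smul_nonneg (by norm_num) ((IsSelfAdjoint.one _).add hM).mul_self_nonneg

theorem le_one_of_sq_eq_one {M : H →L[ℂ] H} (hM : IsSelfAdjoint M) (hsq : M ^ 2 = 1) : M ≤ 1 :=
  neg_le_neg_iff.1 (neg_one_le_of_sq_eq_one hM.neg (by rw [neg_sq, hsq]))

theorem isState_of_isStarProjection [FiniteDimensional ℂ H] {Q : H →L[ℂ] H}
    (hQ : IsStarProjection Q) (htrace : LinearMap.trace ℂ H Q = 1) : IsState Q where
  isPositive := (ContinuousLinearMap.nonneg_iff_isPositive Q).1 hQ.nonneg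
  hasTrace_one := htrace ▸ hasTrace_linearMapTrace Q

end BoundedEnergy

theorem finrank_ker_of_isIdempotentElem {K V : Type*} [Field K] [AddCommGroup V] [Module K V]
    [FiniteDimensional K V] {Q : V →ₗ[K] V} (hQ : IsIdempotentElem Q) :
    (Module.finrank K (LinearMap.ker Q) : K) = Module.finrank K V - LinearMap.trace K V Q := by
  rw [LinearMap.IsProj.trace (LinearMap.IsIdempotentElem.isProj_range Q hQ), eq_sub_iff_add_eq']
  exact_mod_cast congrArg (Nat.cast (R := K)) Q.finrank_range_add_finrank_ker

section BlochProjection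

theorem blochMatrix_sq_eq_one {a : Fin 3 → ℝ} (ha : a ⬝ᵥ a = 1) : blochMatrix a ^ 2 = 1 := by
  rw [sq, blochMatrix_mul_self, ha, Complex.ofReal_one, one_smul]

/-- The matrix of the pure qubit state with Bloch vector `a`. -/
noncomputable def blochProjection (a : Fin 3 → ℝ) : Matrix (Fin 2) (Fin 2) ℂ :=
  (2⁻¹ : ℂ) • (1 + blochMatrix a)

theorem isStarProjection_blochProjection {a : Fin 3 → ℝ} (ha : a ⬝ᵥ a = 1) :
    IsStarProjection (blochProjection a) where
  isIdempotentElem := by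
    have hsq : (1 + blochMatrix a) * (1 + blochMatrix a) = (2 : ℂ) • (1 + blochMatrix a) := by
      rw [← sq, (Commute.one_left _).add_sq, blochMatrix_sq_eq_one ha, one_pow, mul_one, two_mul]
      module
    rw [IsIdempotentElem, blochProjection, smul_mul_smul_comm, hsq]
    module
  isSelfAdjoint := by
    have hone : IsSelfAdjoint (1 : Matrix (Fin 2) (Fin 2) ℂ) := .one _
    exact IsSelfAdjoint.smul (by simp [IsSelfAdjoint]) (hone.add (isHermitian_blochMatrix a))

theorem trace_blochProjection (a : Fin 3 → ℝ) : (blochProjection a).trace = 1 := by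
  simp [blochProjection, trace_blochMatrix, Matrix.trace_add, Matrix.trace_smul]

theorem trace_blochProjection_mul_blochMatrix (a b : Fin 3 → ℝ) :
    (blochProjection a * blochMatrix b).trace = ((a ⬝ᵥ b : ℝ) : ℂ) := by
  simp [blochProjection, add_mul, trace_blochMatrix, trace_blochMatrix_mul]

theorem trace_blochProjection_mul (a b : Fin 3 → ℝ) :
    (blochProjection a * blochProjection b).trace = (((1 + a ⬝ᵥ b) / 2 : ℝ) : ℂ) := by
  rw [blochProjection.eq_1 b, mul_smul_comm, mul_add, mul_one, Matrix.trace_smul, Matrix.trace_add,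
    trace_blochProjection, trace_blochProjection_mul_blochMatrix, smul_eq_mul]
  push_cast
  ring

variable {a b : Fin 3 → ℝ}

theorem isStarProjection_qubitOp_blochProjection (ha : a ⬝ᵥ a = 1) :
    IsStarProjection (qubitOp.{u} (blochProjection a)) :=
  (isStarProjection_blochProjection ha).map qubitOp

theorem isState_qubitOp_blochProjection (ha : a ⬝ᵥ a = 1) :
    IsState (qubitOp.{u} (blochProjection a)) :=
  isState_of_isStarProjection (isStarProjection_qubitOp_blochProjection ha) (by
    rw [trace_qubitOp, trace_blochProjection])

theorem hasTrace_qubitOp_mul (M N : Matrix (Fin 2) (Fin 2) ℂ) :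
    HasTrace (qubitOp.{u} M * qubitOp N) (M * N).trace := by
  rw [← map_mul, ← trace_qubitOp.{u}]
  exact hasTrace_linearMapTrace _

theorem isEnergyObservable_blochProjection (ha : a ⬝ᵥ a = 1) :
    IsEnergyObservable ((qubitOp.{u} (blochProjection a) : Qubit →ₗ[ℂ] Qubit).toPMap ⊤) := by
  have hQ := isStarProjection_qubitOp_blochProjection.{u} ha
  refine isEnergyObservable_toPMap_top hQ ?_
  have hker := finrank_ker_of_isIdempotentElem (Q := (qubitOp.{u} (blochProjection a)).toLinearMap)
    (congrArg ContinuousLinearMap.toLinearMap hQ.isIdempotentElem)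
  rw [trace_qubitOp, trace_blochProjection, finrank_euclideanSpace, Fintype.card_ulift,
    Fintype.card_fin] at hker
  norm_num at hker
  exact_mod_cast hker

end BlochProjection

section MaximallyEntangled

variable {ι : Type*} [Fintype ι] {HA : Type v} {HB : Type w} [NormedAddCommGroup HA]
  [InnerProductSpace ℂ HA] [NormedAddCommGroup HB] [InnerProductSpace ℂ HB]

/-- The maximally entangled vector `(∑ i, e i ⊗ f i) / √d`, where `d` is the size of `ι`. -/
noncomputable def maxEntangled (e : ι → HA) (f : ι → HB) : HilbertTensor HA HB :=
  (((√(Fintype.card ι))⁻¹ : ℝ) : ℂ) • ((∑ i, e i ⊗ₜ[ℂ] f i : HA ⊗[ℂ] HB) : HilbertTensor HA HB)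

theorem inner_maxEntangled_tensorOp (e : ι → HA) (f : ι → HB) (A : HA →L[ℂ] HA)
    (B : HB →L[ℂ] HB) :
    ⟪maxEntangled e f, tensorOp A B (maxEntangled e f)⟫_ℂ =
      (Fintype.card ι : ℂ)⁻¹ * ∑ i, ∑ j, ⟪e i, A (e j)⟫_ℂ * ⟪f i, B (f j)⟫_ℂ := by
  have hsq : (((√(Fintype.card ι))⁻¹ : ℝ) : ℂ) * (((√(Fintype.card ι))⁻¹ : ℝ) : ℂ) =
      (Fintype.card ι : ℂ)⁻¹ := by
    rw [← Complex.ofReal_mul, ← mul_inv, Real.mul_self_sqrt (Nat.cast_nonneg _)]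
    push_cast
    rfl
  rw [maxEntangled, map_smul, inner_smul_left, inner_smul_right, Complex.conj_ofReal, ← mul_assoc,
    hsq, tensorOp_coe, UniformSpace.Completion.inner_coe]
  simp only [map_sum, TensorProduct.mapL_tmul, sum_inner, inner_sum, TensorProduct.inner_tmul]
  rw [Finset.sum_comm]

theorem norm_maxEntangled [Nonempty ι] {e : ι → HA} {f : ι → HB} (he : Orthonormal ℂ e)
    (hf : Orthonormal ℂ f) : ‖maxEntangled e f‖ = 1 := by
  classical
  have h := inner_maxEntangled_tensorOp e f 1 1
  simp only [tensorOp_one_one, one_apply_eq_self, orthonormal_iff_ite.1 he,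
    orthonormal_iff_ite.1 hf, mul_ite, mul_one, mul_zero, Finset.sum_ite_eq,
    Finset.mem_univ, if_true, Finset.sum_const, Finset.card_univ, nsmul_eq_mul] at h
  have hre := congrArg Complex.re h
  rw [inv_mul_cancel₀ (Nat.cast_ne_zero.2 Fintype.card_ne_zero), re_inner_self,
    Complex.one_re] at hre
  exact (pow_eq_one_iff_of_nonneg (norm_nonneg _) two_ne_zero).1 hre

end MaximallyEntangled

theorem inner_maxEntangled_qubitOp (M N : Matrix (Fin 2) (Fin 2) ℂ) :
    ⟪maxEntangled qubitBasis.{v} qubitBasis.{w},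
      tensorOp (qubitOp M) (qubitOp N.transpose) (maxEntangled qubitBasis qubitBasis)⟫_ℂ =
      2⁻¹ * (M * N).trace := by
  rw [inner_maxEntangled_tensorOp]
  simp only [inner_qubitBasis_qubitOp, Matrix.transpose_apply, Fintype.card_fin, Matrix.trace,
    Matrix.diag, Matrix.mul_apply, Nat.cast_ofNat]

theorem isSelfAdjoint_qubitOp_and_sq_eq_one {M : Matrix (Fin 2) (Fin 2) ℂ} (hM : M.IsHermitian)
    (hsq : M ^ 2 = 1) : IsSelfAdjoint (qubitOp.{u} M) ∧ qubitOp.{u} M ^ 2 = 1 :=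
  ⟨IsSelfAdjoint.map hM qubitOp, by rw [← map_pow, hsq, map_one]⟩

theorem mem_bellQuantumSet_of_isCorrelationTriple {C : Fin 2 → Fin 2 → ℝ} {c : ℝ}
    (h : ∀ x, IsCorrelationTriple (C x 0) (C x 1) c) : C ∈ bellQuantumSet.{v, w} := by
  obtain ⟨a, b, ha, hb, hab₀, hab₁⟩ := exists_unit_vectors_of_isCorrelationTriple h
  have hC (x y : Fin 2) : a x ⬝ᵥ b y = C x y := by
    fin_cases y
    exacts [hab₀ x, hab₁ x]
  refine ⟨Qubit, _, _, inferInstance, Qubit, _, _, inferInstance, _,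
    fun x => qubitOp (blochMatrix (a x)), fun y => qubitOp (blochMatrix (b y)).transpose,
    isState_rankOne (norm_maxEntangled qubitBasis.orthonormal qubitBasis.orthonormal),
    fun x => isSelfAdjoint_qubitOp_and_sq_eq_one (isHermitian_blochMatrix _)
      (blochMatrix_sq_eq_one (ha x)),
    fun y => isSelfAdjoint_qubitOp_and_sq_eq_one (isHermitian_blochMatrix _).transpose
      (by rw [← Matrix.transpose_pow, blochMatrix_sq_eq_one (hb y), Matrix.transpose_one]),
    fun x y => ?_⟩
  have htrace := hasTrace_rankOne_mul (maxEntangled qubitBasis.{v} qubitBasis.{w})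
    (maxEntangled qubitBasis qubitBasis)
    (tensorOp (qubitOp (blochMatrix (a x))) (qubitOp (blochMatrix (b y)).transpose))
  rwa [inner_maxEntangled_qubitOp, trace_blochMatrix_mul, inv_mul_cancel_left₀ two_ne_zero, hC]
    at htrace

theorem mem_bellQuantumSet_iff {C : Fin 2 → Fin 2 → ℝ} :
    C ∈ bellQuantumSet.{v, w} ↔ ∃ c, ∀ x, IsCorrelationTriple (C x 0) (C x 1) c :=
  ⟨exists_isCorrelationTriple_of_mem_bellQuantumSet,
    fun ⟨_, h⟩ => mem_bellQuantumSet_of_isCorrelationTriple h⟩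

theorem gramSet_subset_realizableBehaviours : gramSet ⊆ realizableBehaviours.{u} := by
  rintro p ⟨F, c, h⟩
  obtain ⟨a, b, ha, hb, hE, hF⟩ := exists_unit_vectors_of_isCorrelationTriple fun x => (h x).1
  obtain ⟨hM, hMsq⟩ := isSelfAdjoint_qubitOp_and_sq_eq_one.{u} (isHermitian_blochMatrix (b 0))
    (blochMatrix_sq_eq_one (hb 0))
  have hρ (x : Fin 2) : IsState (qubitOp (blochProjection (a x))) :=
    isState_qubitOp_blochProjection (ha x)
  refine ⟨Qubit, _, _, inferInstance, fun x => qubitOp (blochProjection (a x)),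
    qubitOp (blochMatrix (b 0)), _, hρ, hM, neg_one_le_of_sq_eq_one hM hMsq,
    le_one_of_sq_eq_one hM hMsq, isEnergyObservable_blochProjection (hb 1), fun x => ?_,
    fun x => (hρ x).meanEnergy_toPMap_le.trans (EReal.coe_le_coe_iff.2 ?_)⟩
  · have htrace := hasTrace_qubitOp_mul.{u} (blochProjection (a x)) (blochMatrix (b 0))
    rwa [trace_blochProjection_mul_blochMatrix, hE] at htrace
  · have htrace := hasTrace_qubitOp_mul.{u} (blochProjection (a x)) (blochProjection (b 1))
    rw [trace_blochProjection_mul, hF] at htrace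
    rw [(hρ x).expectation_eq htrace]
    linarith [(h x).2]

theorem quantumSet_eq_gramSet : quantumSet.{u} = gramSet :=
  quantumSet_subset_gramSet.antisymm
    (gramSet_subset_realizableBehaviours.trans (subset_convexHull ℝ _))

end EnergyCorrelations

theorem proposition7 (E ω : Fin 2 → ℝ) :
    (E, ω) ∈ EnergyCorrelations.quantumSet.{u} ↔
      ∃ C ∈ EnergyCorrelations.bellQuantumSet.{v, w},
        (∀ x, C x 0 = E x) ∧ ∀ x, C x 1 ≤ 2 * ω x - 1 := by
  rw [EnergyCorrelations.quantumSet_eq_gramSet]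
  constructor
  · rintro ⟨F, c, h⟩
    exact ⟨fun x => ![E x, F x],
      EnergyCorrelations.mem_bellQuantumSet_iff.2 ⟨c, fun x => (h x).1⟩,
      fun _ => rfl, fun x => (h x).2⟩
  · rintro ⟨C, hC, hE, hω⟩
    obtain rfl : (fun x => C x 0) = E := funext hE
    obtain ⟨c, hc⟩ := EnergyCorrelations.mem_bellQuantumSet_iff.1 hC
    exact ⟨fun x => C x 1, c, fun x => ⟨hc x, hω x⟩⟩
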